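/- **Definitions.** For $C\in\mathbb R^{n\times m}$, let $\mathcal Q(C)$ be the set of real $n\times m$ matrices with the same sign pattern ($+,-,0$) as $C$, and let $\mathcal Q_0(C)$ be its closure in $\mathbb R^{n\times m}$. A real square matrix is a *$P_0$-matrix* if all its principal minors are nonnegative. *DSR graphs.* Let $A\in\mathbb R^{n\times m}$ and $B\in\mathbb R^{m\times n}$. The DSR graph $G_{A,B}$ is the signed, labelled bipartite digraph on S-vertices $S_1,\dots,S_n$ and R-vertices $R_1,\dots,R_m$ with an arc $R_j\to S_i$ of the sign of $A_{ij}$ whenever $A_{ij}\ne0$, and an arc $S_i\to R_j$ of the sign of $B_{ji}$ whenever $B_{ji}\neq 0$; a pair of antiparallel arcs of the same sign is treated as one undirected edge. An edge that comes from $A_{ij}$ (and possibly also from $B_{ji}$) has label $|A_{ij}|$; an edge that comes only from $B$ has label $\infty$. A *cycle* is a nonempty closed walk, respecting the orientation of the edges, that repeats no vertex (other than its first vertex as its last) and no edge. A cycle $(e_1,\dots,e_{2r})$ is an *e-cycle* if $(-1)^{r}\prod_{i}\operatorname{sign}(e_i)=1$ and an *o-cycle* if this number is $-1$; it is an *s-cycle*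 if all its labels $l(e_i)$ are finite and $\prod_{i=1}^{r} l(e_{2i-1})=\prod_{i=1}^{r} l(e_{2i})$. Two cycles have *odd intersection* if they share an edge, can be oriented so that they induce the same orientation on every common edge, and each connected component of the subgraph formed by their common edges has an odd number of edges. A DSR graph is *odd\** if all its e-cycles are s-cycles and no two of its e-cycles have odd intersection. *Second additive compound.* For $M\in\mathbb R^{n\times n}$, $n\ge2$, $M^{[2]}$ is the $\binom n2\times\binom n2$ matrix, in the basis $(e_i\wedge e_j)_{i<j}$ of $\Lambda^2\mathbb R^n$, of the linear map $u\wedge v\mapsto Mu\wedge v+u\wedge Mv$. *The DSR$^{[2]}$ graph.* For $A\in\mathbb R^{n\times m}$ and $B\in\mathbb R^{m\times n}$, let $\overline{\mathbf L}^A$ be the $\binom n2\times mn$ matrix with rows indexed by pairs $(i,j)$, $i<j$, and columns by pairs $(k,l)\in\{1,\dots,m\}\times\{1,\dots,n\}$, with entries $$\overline{\mathbf L}^A_{(i,j),(k,l)}=\begin{cases}A_{jk}&(l=i)\\-A_{ik}&(l=j)\\0&\text{otherwise,}\end{cases}$$ and let $\underline{\mathbf L}^B=\bigl(\overline{\mathbf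 L}^{B^t}\bigr)^t$. (These satisfy $(AB)^{[2]}=\overline{\mathbf L}^A\underline{\mathbf L}^B$.) The DSR$^{[2]}$ graph of $AB$ is $G^{[2]}_{A,B}=G_{\overline{\mathbf L}^A,\,\underline{\mathbf L}^B}$. **Theorem.** Let $C\in\mathbb R^{3\times m}$, and let $A\in\mathbb R^{3\times m}$ and $B\in\mathbb R^{m\times3}$ be such that $A\in\mathcal Q_0(C)$ and $B^t\in\mathcal Q_0(C)$. Suppose that in $G_{A,B}$ (i) all e-cycles of length $4$ are s-cycles, and (ii) all o-cycles of length $6$ are s-cycles. Then $G^{[2]}_{A,B}$ is odd\*, $(AB)^{[2]}$ is a $P_0$-matrix, and no nonreal eigenvalue of $AB$ lies in the open left half-plane $\{z\in\mathbb C:\operatorname{Re} z<0\}$. -/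

import Mathlib

open scoped ENNReal

/-- The qualitative class of a real matrix `C`: all real matrices with the sign pattern of `C`. -/
def qualClass {ι κ : Type*} (C : Matrix ι κ ℝ) : Set (Matrix ι κ ℝ) :=
  {X | ∀ i j, (0 < C i j → 0 < X i j) ∧ (C i j < 0 → X i j < 0) ∧ (C i j = 0 → X i j = 0)}

/-- The closure of the qualitative class of `C` in the space of real matrices. -/
def qualClosure {ι κ : Type*} (C : Matrix ι κ ℝ) : Set (Matrix ι κ ℝ) :=
  closure (qualClass C)

/-- A real square matrix is a `P₀`-matrix if all its principal minors are nonnegative. -/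
def IsPZeroMatrix {ι : Type*} [DecidableEq ι] (M : Matrix ι ι ℝ) : Prop :=
  ∀ α : Finset ι, α.Nonempty →
    0 ≤ (M.submatrix (Subtype.val : α → ι) (Subtype.val : α → ι)).det

/-! ### DSR graphs -/

/-- A potential edge of a signed bipartite multigraph on S-vertices `S` and R-vertices `R`:
an S-vertex, an R-vertex and a sign. Between an S-vertex and an R-vertex there is at most one edge
of each sign, so that two antiparallel arcs of the same sign form one single (undirected) edge,
while two antiparallel arcs of opposite signs are two different edges. -/
@[ext]
structure DSREdge (S R : Type*) where
  s : S
  r : R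
  sign : SignType

/-- A signed, labelled, bipartite digraph on S-vertices `S` and R-vertices `R`: it says which edges
have S-to-R orientation, which edges have R-to-S orientation (an edge with both orientations is
undirected), and gives the label of each edge. -/
structure DSRGraph (S R : Type*) where
  sToR : DSREdge S R → Prop
  rToS : DSREdge S R → Prop
  label : DSREdge S R → ℝ≥0∞

open Classical in
/-- The DSR graph `G_{A,B}`. There is an arc from `R_j` to `S_i`, with the sign of `A i j`,
if and only if `A i j ≠ 0`; there is an arc from `S_i` to `R_j`, with the sign of `B j i`,
if and only if `B j i ≠ 0`. An edge that comes from `A i j` has label `|A i j|`; an edge that comes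
only from `B` has label `∞`. -/
noncomputable def dsrGraph {S R : Type*} (A : Matrix S R ℝ) (B : Matrix R S ℝ) : DSRGraph S R where
  sToR e := B e.r e.s ≠ 0 ∧ SignType.sign (B e.r e.s) = e.sign
  rToS e := A e.s e.r ≠ 0 ∧ SignType.sign (A e.s e.r) = e.sign
  label e :=
    if A e.s e.r ≠ 0 ∧ SignType.sign (A e.s e.r) = e.sign then ENNReal.ofReal |A e.s e.r| else ∞

/-- An edge together with a direction of traversal: from its S-vertex to its R-vertex if
`forward = true`, from its R-vertex to its S-vertex if `forward = false`. -/
@[ext]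
structure DSRDart (S R : Type*) where
  edge : DSREdge S R
  forward : Bool

namespace DSRDart

variable {S R : Type*}

/-- The start-point of a directed edge. -/
def source (d : DSRDart S R) : S ⊕ R :=
  if d.forward then Sum.inl d.edge.s else Sum.inr d.edge.r

/-- The end-point of a directed edge. -/
def target (d : DSRDart S R) : S ⊕ R :=
  if d.forward then Sum.inr d.edge.r else Sum.inl d.edge.s

end DSRDart

namespace DSRGraph

variable {S R : Type*} (G : DSRGraph S R)

/-- The directed edge `d` is an arc of the graph. -/
def HasArc (d : DSRDart S R) : Prop :=
  if d.forward then G.sToR d.edge else G.rToS d.edge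

/-- A nonempty closed walk, given as the list of its successive directed edges. -/
def IsClosedWalk (w : List (DSRDart S R)) : Prop :=
  w ≠ [] ∧ (∀ d ∈ w, G.HasArc d) ∧ w.IsChain (fun d d' => d.target = d'.source) ∧
    w.getLast?.map DSRDart.target = w.head?.map DSRDart.source

/-- A cycle is a nonempty closed walk that repeats no vertex (except that its first and last
vertices coincide) and no edge. The list carries a starting point and an orientation. -/
def IsCycle (w : List (DSRDart S R)) : Prop :=
  G.IsClosedWalk w ∧ (w.map DSRDart.source).Nodup ∧ (w.map DSRDart.edge).Nodup

/-- The sign of a walk is the product of the signs of its edges. -/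
def walkSign (w : List (DSRDart S R)) : SignType :=
  (w.map fun d => d.edge.sign).prod

/-- The parity of a walk `w` of even length: `(-1) ^ (|w| / 2) * sign w`. -/
def parity (w : List (DSRDart S R)) : SignType :=
  (-1) ^ (w.length / 2) * walkSign w

/-- An e-cycle is a cycle of parity `1`. -/
def IsECycle (w : List (DSRDart S R)) : Prop :=
  G.IsCycle w ∧ parity w = 1

/-- An o-cycle is a cycle of parity `-1`. -/
def IsOCycle (w : List (DSRDart S R)) : Prop :=
  G.IsCycle w ∧ parity w = -1

/-- An s-cycle is a cycle all of whose labels are finite and for which the product of the labels of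
every other edge equals the product of the labels of the remaining edges. -/
def IsSCycle (w : List (DSRDart S R)) : Prop :=
  G.IsCycle w ∧ (∀ d ∈ w, G.label d.edge ≠ ∞) ∧
    ∏ i ∈ Finset.univ.filter (fun i : Fin w.length => Even i.val), G.label (w.get i).edge =
      ∏ i ∈ Finset.univ.filter (fun i : Fin w.length => Odd i.val), G.label (w.get i).edge

/-- The edges that lie on both walks. -/
def commonEdges (w₁ w₂ : List (DSRDart S R)) : Set (DSREdge S R) :=
  {e | e ∈ w₁.map DSRDart.edge ∧ e ∈ w₂.map DSRDart.edge}

/-- The connected component of the edge `e` in the subgraph formed by the edges in `E`: the edges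
reached from `e` through successively incident edges of `E`. -/
def edgeComponent (E : Set (DSREdge S R)) (e : DSREdge S R) : Set (DSREdge S R) :=
  {f | Relation.ReflTransGen (fun a b => a ∈ E ∧ b ∈ E ∧ (a.s = b.s ∨ a.r = b.r)) e f}

/-- Two oriented cycles have odd intersection if they induce the same orientation on every common
edge, they have a common edge, and each component of their intersection has odd length. -/
def HaveOddIntersection (w₁ w₂ : List (DSRDart S R)) : Prop :=
  (∀ d₁ ∈ w₁, ∀ d₂ ∈ w₂, d₁.edge = d₂.edge → d₁.forward = d₂.forward) ∧
    (commonEdges w₁ w₂).Nonempty ∧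
    ∀ e ∈ commonEdges w₁ w₂, Odd (edgeComponent (commonEdges w₁ w₂) e).ncard

/-- A DSR graph is odd* if all its e-cycles are s-cycles and no two of its e-cycles have odd
intersection. -/
def IsOddStar : Prop :=
  (∀ w, G.IsECycle w → G.IsSCycle w) ∧
    ∀ w₁ w₂, G.IsECycle w₁ → G.IsECycle w₂ → ¬ HaveOddIntersection w₁ w₂

end DSRGraph

/-! ### The second additive compound and the `DSR^{[2]}` graph -/

/-- The pairs `(i, j)` with `i < j`, which index the basis `e_i ∧ e_j` of `Λ²ℝⁿ`. -/
abbrev IdxPair (n : ℕ) : Type := {p : Fin n × Fin n // p.1 < p.2}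

/-- The coordinates of `u ∧ v` in the basis `e_i ∧ e_j`, `i < j`, of `Λ²ℝⁿ`. -/
def wedgeCoord {n : ℕ} (u v : Fin n → ℝ) (p : IdxPair n) : ℝ :=
  u p.1.1 * v p.1.2 - u p.1.2 * v p.1.1

/-- Expansion of an alternating bilinear map in the standard basis. -/
theorem alternating_eq_sum_wedgeCoord {n : ℕ} {N : Type*} [AddCommGroup N] [Module ℝ N]
    (f : (Fin n → ℝ) [⋀^Fin 2]→ₗ[ℝ] N) (u v : Fin n → ℝ) :
    f ![u, v] =
      ∑ p : IdxPair n, wedgeCoord u v p •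
        f ![(Pi.single p.1.1 1 : Fin n → ℝ), (Pi.single p.1.2 1 : Fin n → ℝ)] := by
  obtain ⟨W, hW⟩ : ∃ W : (Fin n → ℝ) → (Fin n → ℝ) → N, ∀ x y, W x y = f ![x, y] :=
    ⟨fun x y => f ![x, y], fun _ _ => rfl⟩
  have hupd : ∀ x y z : Fin n → ℝ, Function.update ![x, y] 0 z = ![z, y] := fun x y z => by
    ext i
    fin_cases i <;> rfl
  have hadd : ∀ x x' y, W (x + x') y = W x y + W x' y := fun x x' y => by
    simpa only [hW, hupd] using f.map_update_add ![x, y] 0 x x'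
  have hsmul : ∀ (c : ℝ) x y, W (c • x) y = c • W x y := fun c x y => by
    simpa only [hW, hupd] using f.map_update_smul ![x, y] 0 c x
  have hself : ∀ x, W x x = 0 := fun x => by
    rw [hW]
    exact f.map_eq_zero_of_eq ![x, x] (i := 0) (j := 1) (by simp) (by decide)
  have hswap : ∀ x y, W y x = - W x y := fun x y => by
    rw [hW, hW, ← f.map_swap ![x, y] (i := 0) (j := 1) (by decide)]
    refine congrArg f ?_
    ext i
    fin_cases i <;> rfl
  let L : (Fin n → ℝ) → (Fin n → ℝ) →ₗ[ℝ] N := fun y =>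
    { toFun := fun x => W x y, map_add' := fun x x' => hadd x x' y,
      map_smul' := fun c x => hsmul c x y }
  have hleft : ∀ (x y : Fin n → ℝ), W x y = ∑ i, x i • W (Pi.single i 1) y := fun x y => by
    conv_lhs => rw [pi_eq_sum_univ' x]
    exact (map_sum (L y) _ _).trans (Finset.sum_congr rfl fun i _ => (L y).map_smul _ _)
  have hall : W u v = ∑ p : Fin n × Fin n,
      (u p.1 * v p.2) • W (Pi.single p.1 1) (Pi.single p.2 1) := by
    rw [hleft, Fintype.sum_prod_type]
    refine Finset.sum_congr rfl fun i _ => ?_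
    rw [hswap, hleft, ← Finset.sum_neg_distrib, Finset.smul_sum]
    refine Finset.sum_congr rfl fun j _ => ?_
    rw [← smul_neg, ← hswap, smul_smul]
  simp only [← hW]
  have hlt : ∀ f : Fin n × Fin n → N,
      ∑ p : IdxPair n, f p.1 = ∑ p : Fin n × Fin n, if p.1 < p.2 then f p else 0 := fun f => by
    rw [← Finset.sum_filter]
    exact (Finset.sum_subtype _ (by simp) f).symm
  have hr := hlt fun p => (u p.1 * v p.2 - u p.2 * v p.1) • W (Pi.single p.1 1) (Pi.single p.2 1)
  refine Eq.trans ?_ hr.symm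
  have hsw : ∑ p : Fin n × Fin n,
        (if p.2 < p.1 then (u p.1 * v p.2) • W (Pi.single p.1 1) (Pi.single p.2 1) else 0) =
      ∑ p : Fin n × Fin n,
        (if p.1 < p.2 then (u p.2 * v p.1) • W (Pi.single p.2 1) (Pi.single p.1 1) else 0) :=
    (Equiv.sum_comp (Equiv.prodComm (Fin n) (Fin n)) _).symm
  have hsplit : ∀ p : Fin n × Fin n, (u p.1 * v p.2) • W (Pi.single p.1 1) (Pi.single p.2 1) =
      (if p.1 < p.2 then (u p.1 * v p.2) • W (Pi.single p.1 1) (Pi.single p.2 1) else 0) +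
      (if p.2 < p.1 then (u p.1 * v p.2) • W (Pi.single p.1 1) (Pi.single p.2 1) else 0) :=
    fun p => by
      rcases lt_trichotomy p.1 p.2 with h | h | h
      · simp [h, h.asymm]
      · simp [h, hself]
      · simp [h, h.asymm]
  rw [hall, Finset.sum_congr rfl fun p _ => hsplit p, Finset.sum_add_distrib, hsw,
    ← Finset.sum_add_distrib]
  refine Finset.sum_congr rfl fun p _ => ?_
  split_ifs with h
  · rw [hswap (Pi.single p.1 1) (Pi.single p.2 1), smul_neg, sub_smul, sub_eq_add_neg]
  · simp

/-- `wedgeCoord u v` are indeed the coordinates of `u ∧ v` in the second exterior power of `ℝⁿ`. -/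
theorem sum_wedgeCoord {n : ℕ} (u v : Fin n → ℝ) :
    exteriorPower.ιMulti ℝ 2 ![u, v] =
      ∑ p : IdxPair n, wedgeCoord u v p •
        exteriorPower.ιMulti ℝ 2
          ![(Pi.single p.1.1 1 : Fin n → ℝ), (Pi.single p.1.2 1 : Fin n → ℝ)] :=
  alternating_eq_sum_wedgeCoord _ u v

/-- The matrix, in the basis `e_i ∧ e_j`, `i < j`, of the second additive compound `M^{[2]}`, which
is the linear map on `Λ²ℝⁿ` with `M^{[2]} (u ∧ v) = M u ∧ v + u ∧ M v`. -/
def additiveCompoundTwo {n : ℕ} (M : Matrix (Fin n) (Fin n) ℝ) :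
    Matrix (IdxPair n) (IdxPair n) ℝ :=
  fun p q =>
    wedgeCoord (M.mulVec (Pi.single q.1.1 1)) (Pi.single q.1.2 1) p +
      wedgeCoord (Pi.single q.1.1 1) (M.mulVec (Pi.single q.1.2 1)) p

/-- The matrix `L̄^A`, with rows indexed by pairs `(i, j)`, `i < j`, and columns by pairs `(k, l)`:
its `k`-th block is the matrix of `x ↦ x sᵗ - s xᵗ` from `ℝⁿ` to the antisymmetric matrices, where
`s` is the `k`-th column of `A`. -/
def upperL {n : ℕ} {R : Type*} (A : Matrix (Fin n) R ℝ) : Matrix (IdxPair n) (R × Fin n) ℝ :=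
  fun p c =>
    if c.2 = p.1.1 then A p.1.2 c.1 else if c.2 = p.1.2 then -A p.1.1 c.1 else 0

/-- The matrix `L̲^B`, with rows indexed by pairs `(k, l)` and columns by pairs `(i, j)`, `i < j`:
its `k`-th block is the matrix of `X ↦ X vᵗ` from the antisymmetric matrices to `ℝⁿ`, where
`v` is the `k`-th row of `B`. -/
def lowerL {n : ℕ} {R : Type*} (B : Matrix R (Fin n) ℝ) : Matrix (R × Fin n) (IdxPair n) ℝ :=
  fun c p =>
    if c.2 = p.1.1 then B c.1 p.1.2 else if c.2 = p.1.2 then -B c.1 p.1.1 else 0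

/-- The `DSR^{[2]}` graph of the product `A * B`. -/
noncomputable def dsrGraphTwo {n : ℕ} {R : Type*} (A : Matrix (Fin n) R ℝ)
    (B : Matrix R (Fin n) ℝ) : DSRGraph (IdxPair n) (R × Fin n) :=
  dsrGraph (upperL A) (lowerL B)

/-! The graph hypotheses turn into identities between entries. For sign-compatible `A`, `B`, a
positive 4-cycle is an e-cycle and a positive 6-cycle an o-cycle; being an s-cycle then equates its
two alternating products of entries of `A`, signs included.

Write `M = A * B`, and let `E₁`, `E₂`, `E₃` be the sums of its principal minors of each size. Twice
a principal 2-minor, and `2 M₀₀M₁₁M₂₂` minus the two cyclic products of off-diagonal entries, are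
sums of terms `(x - y)(x' - y')` with `x`, `y` products from `A` and `x'`, `y'` products from `B`.
Sign compatibility gives `xx', yy' ≥ 0`, and a positive cross term is a positive cycle, which forces
`x = y`. Hence both quantities are nonnegative, and so is `E₁E₂ - E₃ = det M^[2]`. The smaller
principal minors of `M^[2]` follow from those of `M`. Moreover `E₁E₂ - E₃` is the product of the
sums of two eigenvalues of `M`, a positive multiple of `Re z` for a nonreal eigenvalue `z`.

For odd*: an R-vertex `(k, l)` of the DSR^[2] graph is adjacent only to the two pairs containing
`l`, so cycles that meet there share both edges or none, and common edges come in twos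
(`not_haveOddIntersection_of_degree_le_two`). There are three S-vertices, so cycles have length 4 or
6, and e-cycles of these lengths come from positive closed walks in the original graph. -/

/-- `A` and `Bᵗ` lie in the closure of a common qualitative class. -/
def SignCompatible {S R : Type*} (A : Matrix S R ℝ) (B : Matrix R S ℝ) : Prop :=
  ∀ s r, (0 ≤ A s r ∧ 0 ≤ B r s) ∨ (A s r ≤ 0 ∧ B r s ≤ 0)

/-- The `2 × 2` minors of `A` belonging to a positive directed cycle `i → k → j → l → i` vanish. -/
def PosFourCycleMinorsVanish {S R : Type*} (A : Matrix S R ℝ) (B : Matrix R S ℝ) : Prop :=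
  ∀ i j k l, 0 < B k i * A j k * B l j * A i l → A i k * A j l = A j k * A i l

/-- Along a positive directed cycle `i₁ → k₁ → i₂ → k₂ → i₃ → k₃ → i₁`, the two products of
alternate entries of `A` agree. -/
def PosSixCyclesBalanced {S R : Type*} (A : Matrix S R ℝ) (B : Matrix R S ℝ) : Prop :=
  ∀ i₁ i₂ i₃ k₁ k₂ k₃, i₁ ≠ i₂ → i₁ ≠ i₃ → i₂ ≠ i₃ →
    0 < B k₁ i₁ * A i₂ k₁ * (B k₂ i₂ * A i₃ k₂) * (B k₃ i₃ * A i₁ k₃) →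
      A i₁ k₁ * A i₂ k₂ * A i₃ k₃ = A i₂ k₁ * A i₃ k₂ * A i₁ k₃

/-! ### Sign compatibility and an elementary inequality. -/

section Sign

variable {S R : Type*} {A : Matrix S R ℝ} {B : Matrix R S ℝ} {C : Matrix S R ℝ}

/-- Weak sign conditions on an entry are closed, so they pass from the class to its closure. Entries
may vanish in the limit, so only weak inequalities survive. -/
theorem signCompatible_of_mem_qualClosure (hA : A ∈ qualClosure C)
    (hB : B.transpose ∈ qualClosure C) : SignCompatible A B := by
  have nonneg : ∀ X ∈ qualClosure C, ∀ s r, 0 ≤ C s r → 0 ≤ X s r := by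
    intro X hX s r hC
    refine closure_minimal (t := {X : Matrix S R ℝ | 0 ≤ X s r}) ?_
      (isClosed_le continuous_const (by fun_prop)) hX
    intro Y hY
    rcases hC.lt_or_eq with h | h
    · exact ((hY s r).1 h).le
    · exact ((hY s r).2.2 h.symm).ge
  have nonpos : ∀ X ∈ qualClosure C, ∀ s r, C s r ≤ 0 → X s r ≤ 0 := by
    intro X hX s r hC
    refine closure_minimal (t := {X : Matrix S R ℝ | X s r ≤ 0}) ?_
      (isClosed_le (by fun_prop) continuous_const) hX
    intro Y hY
    rcases hC.lt_or_eq with h | h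
    · exact ((hY s r).2.1 h).le
    · exact ((hY s r).2.2 h).le
  intro s r
  rcases le_total 0 (C s r) with h | h
  · exact .inl ⟨nonneg A hA s r h, nonneg _ hB s r h⟩
  · exact .inr ⟨nonpos A hA s r h, nonpos _ hB s r h⟩

theorem SignCompatible.entry_mul_nonneg (h : SignCompatible A B) (s : S) (r : R) :
    0 ≤ A s r * B r s := by
  rcases h s r with h | h
  · exact mul_nonneg h.1 h.2
  · exact mul_nonneg_of_nonpos_of_nonpos h.1 h.2

theorem SignCompatible.entry_mul_pos (h : SignCompatible A B) {s : S} {r : R} (hA : A s r ≠ 0)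
    (hB : B r s ≠ 0) : 0 < A s r * B r s :=
  (h.entry_mul_nonneg s r).lt_of_ne (mul_ne_zero hA hB).symm

theorem SignCompatible.sign_eq (h : SignCompatible A B) {s : S} {r : R} (hA : A s r ≠ 0)
    (hB : B r s ≠ 0) : SignType.sign (A s r) = SignType.sign (B r s) := by
  rcases h s r with h | h
  · rw [sign_pos (h.1.lt_of_ne hA.symm), sign_pos (h.2.lt_of_ne hB.symm)]
  · rw [sign_neg (h.1.lt_of_ne hA), sign_neg (h.2.lt_of_ne hB)]

/-- Unless `x = y`, both cross terms of the expanded product are nonpositive. -/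
theorem mul_sub_nonneg_of_pos_imp_eq {x y x' y' : ℝ} (hx : 0 ≤ x * x') (hy : 0 ≤ y * y')
    (h : 0 < x * y' → x = y) (h' : 0 < y * x' → x = y) : 0 ≤ (x - y) * (x' - y') := by
  by_cases hxy : x = y
  · simp [hxy]
  · have h1 := not_lt.1 (mt h hxy)
    have h2 := not_lt.1 (mt h' hxy)
    linarith

theorem eq_of_abs_eq_of_mul_pos {x y : ℝ} (h : |x| = |y|) (hxy : 0 < x * y) : x = y := by
  rcases abs_eq_abs.1 h with h | h
  · exact h
  · nlinarith [sq_nonneg y]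

end Sign

/-! ### Principal minors of the second additive compound -/

section Minors

variable {m : ℕ} {A : Matrix (Fin 3) (Fin m) ℝ} {B : Matrix (Fin m) (Fin 3) ℝ}

theorem SignCompatible.mul_apply_self_nonneg (h : SignCompatible A B) (i : Fin 3) :
    0 ≤ (A * B) i i :=
  (Finset.sum_nonneg fun k _ => h.entry_mul_nonneg i k).trans_eq Matrix.mul_apply.symm

/-- A symmetrised Cauchy–Binet expansion: summing over all ordered `(k, l)` gives twice the minor,
and every summand is nonnegative. -/
theorem SignCompatible.minor_two_nonneg (h : SignCompatible A B)
    (h4 : PosFourCycleMinorsVanish A B) (i j : Fin 3) :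
    0 ≤ (A * B) i i * (A * B) j j - (A * B) i j * (A * B) j i := by
  have key : 0 ≤ ∑ k, ∑ l, (A i k * A j l - A j k * A i l) * (B k i * B l j - B k j * B l i) := by
    refine Finset.sum_nonneg fun k _ => Finset.sum_nonneg fun l _ => ?_
    refine mul_sub_nonneg_of_pos_imp_eq ?_ ?_ (fun hp => ?_) fun hp => ?_
    · exact (mul_nonneg (h.entry_mul_nonneg i k) (h.entry_mul_nonneg j l)).trans_eq (by ring)
    · exact (mul_nonneg (h.entry_mul_nonneg j k) (h.entry_mul_nonneg i l)).trans_eq (by ring)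
    · exact (h4 j i k l (by convert hp using 1; ring)).symm
    · exact h4 i j k l (by convert hp using 1; ring)
  have expand : ∑ k, ∑ l, (A i k * A j l - A j k * A i l) * (B k i * B l j - B k j * B l i) =
      (A * B) i i * (A * B) j j - (A * B) i j * (A * B) j i
        - (A * B) j i * (A * B) i j + (A * B) j j * (A * B) i i := by
    simp only [Matrix.mul_apply, Finset.sum_mul_sum, ← Finset.sum_sub_distrib,
      ← Finset.sum_add_distrib]
    exact Finset.sum_congr rfl fun k _ => Finset.sum_congr rfl fun l _ => by ring
  linarith

/-- The analogue of Cauchy–Binet with a cyclic shift of the three rows in place of a transposition.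
-/
theorem SignCompatible.two_mul_diag_sub_cyclic_nonneg (h : SignCompatible A B)
    (h6 : PosSixCyclesBalanced A B) :
    0 ≤ 2 * ((A * B) 0 0 * (A * B) 1 1 * (A * B) 2 2) - (A * B) 0 1 * (A * B) 1 2 * (A * B) 2 0
      - (A * B) 1 0 * (A * B) 2 1 * (A * B) 0 2 := by
  have key : 0 ≤ ∑ k, ∑ l, ∑ p, (A 0 k * A 1 l * A 2 p - A 1 k * A 2 l * A 0 p) *
      (B k 0 * B l 1 * B p 2 - B k 1 * B l 2 * B p 0) := by
    refine Finset.sum_nonneg fun k _ => Finset.sum_nonneg fun l _ => Finset.sum_nonneg fun p _ => ?_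
    refine mul_sub_nonneg_of_pos_imp_eq ?_ ?_ (fun hp => ?_) fun hp => ?_
    · exact (mul_nonneg (mul_nonneg (h.entry_mul_nonneg 0 k) (h.entry_mul_nonneg 1 l)) (h.entry_mul_nonneg 2 p)).trans_eq (by ring)
    · exact (mul_nonneg (mul_nonneg (h.entry_mul_nonneg 1 k) (h.entry_mul_nonneg 2 l)) (h.entry_mul_nonneg 0 p)).trans_eq (by ring)
    -- The two cross terms are the two cyclic orders of the S-vertices: `1 → k → 0 → p → 2 → l → 1`
    -- here, `0 → k → 1 → l → 2 → p → 0` below.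
    · have := h6 1 0 2 k p l (by decide) (by decide) (by decide) (by convert hp using 1; ring)
      linarith
    · exact h6 0 1 2 k l p (by decide) (by decide) (by decide) (by convert hp using 1; ring)
  have expand : ∑ k, ∑ l, ∑ p, (A 0 k * A 1 l * A 2 p - A 1 k * A 2 l * A 0 p) *
      (B k 0 * B l 1 * B p 2 - B k 1 * B l 2 * B p 0) =
      (A * B) 0 0 * ((A * B) 1 1 * (A * B) 2 2) - (A * B) 0 1 * ((A * B) 1 2 * (A * B) 2 0)
      - (A * B) 1 0 * ((A * B) 2 1 * (A * B) 0 2)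
      + (A * B) 1 1 * ((A * B) 2 2 * (A * B) 0 0) := by
    simp only [Matrix.mul_apply, Finset.sum_mul_sum]
    simp only [Finset.mul_sum, ← Finset.sum_sub_distrib, ← Finset.sum_add_distrib]
    exact Finset.sum_congr rfl fun k _ => Finset.sum_congr rfl fun l _ =>
      Finset.sum_congr rfl fun p _ => by ring
  linarith

/-- `E₁ E₂ - E₃ ≥ 0`, where `Eᵢ` is the sum of the principal minors of size `i`. -/
theorem SignCompatible.trace_mul_sub_det_nonneg (h : SignCompatible A B)
    (h4 : PosFourCycleMinorsVanish A B) (h6 : PosSixCyclesBalanced A B) :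
    0 ≤ ((A * B) 0 0 + (A * B) 1 1 + (A * B) 2 2) *
        (((A * B) 0 0 * (A * B) 1 1 - (A * B) 0 1 * (A * B) 1 0) +
          ((A * B) 0 0 * (A * B) 2 2 - (A * B) 0 2 * (A * B) 2 0) +
          ((A * B) 1 1 * (A * B) 2 2 - (A * B) 1 2 * (A * B) 2 1)) - (A * B).det := by
  have d0 := h.mul_apply_self_nonneg 0
  have d1 := h.mul_apply_self_nonneg 1
  have d2 := h.mul_apply_self_nonneg 2
  have m01 := h.minor_two_nonneg h4 0 1
  have m02 := h.minor_two_nonneg h4 0 2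
  have m12 := h.minor_two_nonneg h4 1 2
  have t := h.two_mul_diag_sub_cyclic_nonneg h6
  rw [Matrix.det_fin_three]
  generalize A * B = M at *
  -- `E₁E₂ - E₃` is the quantity in `t` plus the six products of a principal 2-minor with a diagonal
  -- entry belonging to it.
  linarith [mul_nonneg d0 m01, mul_nonneg d0 m02, mul_nonneg d1 m01, mul_nonneg d1 m12,
    mul_nonneg d2 m02, mul_nonneg d2 m12]

end Minors

theorem IdxPair.three_cases (p : IdxPair 3) :
    p = ⟨(0, 1), by decide⟩ ∨ p = ⟨(0, 2), by decide⟩ ∨ p = ⟨(1, 2), by decide⟩ := by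
  revert p; decide

theorem isPZeroMatrix_of_card_three {ι : Type*} [Fintype ι] [DecidableEq ι] {N : Matrix ι ι ℝ}
    (hι : Fintype.card ι = 3) (h1 : ∀ p, 0 ≤ N p p)
    (h2 : ∀ p q, p ≠ q → 0 ≤ N p p * N q q - N p q * N q p) (h3 : 0 ≤ N.det) :
    IsPZeroMatrix N := by
  intro α hα
  have hpos := hα.card_pos
  have hle : α.card ≤ 3 := hι ▸ α.card_le_univ
  obtain h | h | h : α.card = 1 ∨ α.card = 2 ∨ α.card = 3 := by omega
  · let e := (Fintype.equivFinOfCardEq ((Fintype.card_coe α).trans h)).symm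
    rw [← Matrix.det_submatrix_equiv_self e, Matrix.det_fin_one]
    exact h1 _
  · let e := (Fintype.equivFinOfCardEq ((Fintype.card_coe α).trans h)).symm
    rw [← Matrix.det_submatrix_equiv_self e, Matrix.det_fin_two]
    refine h2 _ _ fun he => ?_
    exact absurd (e.injective (Subtype.ext he)) (by decide)
  · have hu : α = Finset.univ := (Finset.card_eq_iff_eq_univ α).1 (h.trans hι.symm)
    have := Matrix.det_submatrix_equiv_self
      (Equiv.subtypeUnivEquiv (p := (· ∈ α)) fun x => hu ▸ Finset.mem_univ x) N
    exact h3.trans_eq this.symm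

/-- The pairs `(0, 1)`, `(0, 2)`, `(1, 2)`. -/
noncomputable def finThreeEquivIdxPair : Fin 3 ≃ IdxPair 3 :=
  Equiv.ofBijective ![⟨(0, 1), by decide⟩, ⟨(0, 2), by decide⟩, ⟨(1, 2), by decide⟩] (by decide)

/-- The eigenvalues of `M^[2]` are the sums `λᵢ + λⱼ`, whose product is `E₁E₂ - E₃`; here this is
checked by expansion. -/
theorem det_additiveCompoundTwo (M : Matrix (Fin 3) (Fin 3) ℝ) :
    (additiveCompoundTwo M).det = (M 0 0 + M 1 1 + M 2 2) *
        ((M 0 0 * M 1 1 - M 0 1 * M 1 0) + (M 0 0 * M 2 2 - M 0 2 * M 2 0) +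
          (M 1 1 * M 2 2 - M 1 2 * M 2 1)) - M.det := by
  rw [← Matrix.det_submatrix_equiv_self finThreeEquivIdxPair, Matrix.det_fin_three,
    Matrix.det_fin_three]
  simp [finThreeEquivIdxPair, additiveCompoundTwo, wedgeCoord]
  ring

/-- A principal 2-minor has the form `(dᵢ + dⱼ)(dᵢ + dₖ) - MⱼₖMₖⱼ`, that is, `dᵢ² + dᵢdⱼ + dᵢdₖ`
plus a principal 2-minor of `M`. -/
theorem isPZeroMatrix_additiveCompoundTwo {m : ℕ} {A : Matrix (Fin 3) (Fin m) ℝ}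
    {B : Matrix (Fin m) (Fin 3) ℝ} (h : SignCompatible A B)
    (h4 : PosFourCycleMinorsVanish A B) (h6 : PosSixCyclesBalanced A B) :
    IsPZeroMatrix (additiveCompoundTwo (A * B)) := by
  have d := h.mul_apply_self_nonneg
  have m01 := h.minor_two_nonneg h4 0 1
  have m02 := h.minor_two_nonneg h4 0 2
  have m12 := h.minor_two_nonneg h4 1 2
  have t := h.trace_mul_sub_det_nonneg h4 h6
  rw [← det_additiveCompoundTwo] at t
  generalize A * B = M at *
  have d0 := d 0
  have d1 := d 1
  have d2 := d 2
  refine isPZeroMatrix_of_card_three (by decide) (fun p => ?_) (fun p q hpq => ?_) t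
  · rcases p.three_cases with rfl | rfl | rfl <;>
      simp [additiveCompoundTwo, wedgeCoord] <;> linarith
  · rcases p.three_cases with rfl | rfl | rfl <;> rcases q.three_cases with rfl | rfl | rfl <;>
      simp [additiveCompoundTwo, wedgeCoord] at hpq ⊢ <;>
      linarith [mul_nonneg d0 d1, mul_nonneg d0 d2, mul_nonneg d1 d2, mul_nonneg d0 d0,
        mul_nonneg d1 d1, mul_nonneg d2 d2]

/-! ### Nonreal eigenvalues. -/

theorem re_nonneg_of_mem_spectrum {M : Matrix (Fin 3) (Fin 3) ℝ}
    (hM : 0 ≤ (M 0 0 + M 1 1 + M 2 2) *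
        ((M 0 0 * M 1 1 - M 0 1 * M 1 0) + (M 0 0 * M 2 2 - M 0 2 * M 2 0) +
          (M 1 1 * M 2 2 - M 1 2 * M 2 1)) - M.det)
    {z : ℂ} (hz : z ∈ spectrum ℂ (M.map (algebraMap ℝ ℂ))) (him : z.im ≠ 0) : ¬ z.re < 0 := by
  intro hre
  have hdet : (algebraMap ℂ (Matrix (Fin 3) (Fin 3) ℂ) z - M.map (algebraMap ℝ ℂ)).det = 0 := by
    rw [spectrum.mem_iff, Matrix.isUnit_iff_isUnit_det, isUnit_iff_ne_zero, not_not] at hz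
    exact hz
  rw [Matrix.det_fin_three] at hdet
  rw [Matrix.det_fin_three] at hM
  obtain ⟨x, y⟩ := z
  have hr := congrArg Complex.re hdet
  have hi := congrArg Complex.im hdet
  simp [Matrix.algebraMap_matrix_apply] at hr hi him hre
  -- The imaginary part of the characteristic equation, divided by `y ≠ 0`.
  have hi' : 3 * x ^ 2 - y ^ 2 - 2 * (M 0 0 + M 1 1 + M 2 2) * x +
      ((M 0 0 * M 1 1 - M 0 1 * M 1 0) + (M 0 0 * M 2 2 - M 0 2 * M 2 0) +
          (M 1 1 * M 2 2 - M 1 2 * M 2 1)) = 0 := by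
    refine (mul_eq_zero.1 (?_ : y * _ = 0)).resolve_left him
    linear_combination hi
  -- With eigenvalues `x ± iy` and `E₁ - 2x`, this is the product of the three pairwise sums.
  have e : (M 0 0 + M 1 1 + M 2 2) *
        ((M 0 0 * M 1 1 - M 0 1 * M 1 0) + (M 0 0 * M 2 2 - M 0 2 * M 2 0) +
          (M 1 1 * M 2 2 - M 1 2 * M 2 1)) -
      (M 0 0 * M 1 1 * M 2 2 - M 0 0 * M 1 2 * M 2 1 - M 0 1 * M 1 0 * M 2 2 +
        M 0 1 * M 1 2 * M 2 0 + M 0 2 * M 1 0 * M 2 1 - M 0 2 * M 1 1 * M 2 0) =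
      2 * x * ((M 0 0 + M 1 1 + M 2 2 - x) ^ 2 + y ^ 2) := by
    linear_combination hr + (M 0 0 + M 1 1 + M 2 2 - x) * hi'
  rw [e] at hM
  have : 0 < (M 0 0 + M 1 1 + M 2 2 - x) ^ 2 + y ^ 2 := by positivity
  nlinarith

/-! ### Walks and cycles in DSR graphs -/

namespace DSRGraph

variable {S R : Type*}

section General

variable {G : DSRGraph S R}

theorem IsClosedWalk.exists_source_eq_target {w : List (DSRDart S R)} (hw : G.IsClosedWalk w)
    {d : DSRDart S R} (hd : d ∈ w) : ∃ d' ∈ w, d'.source = d.target := by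
  obtain ⟨l₁, l₂, rfl⟩ := List.append_of_mem hd
  obtain ⟨-, -, hc, hcl⟩ := hw
  cases l₂ with
  | nil =>
    cases l₁ with
    | nil => exact ⟨d, by simp, by simpa using hcl.symm⟩
    | cons a l =>
      rw [List.getLast?_append] at hcl
      exact ⟨a, by simp, by simpa using hcl.symm⟩
  | cons b l =>
    refine ⟨b, by simp, ?_⟩
    rw [List.isChain_append] at hc
    exact ((List.isChain_cons_cons.1 hc.2.1).1).symm

theorem IsClosedWalk.exists_target_eq_source {w : List (DSRDart S R)} (hw : G.IsClosedWalk w)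
    {d : DSRDart S R} (hd : d ∈ w) : ∃ d' ∈ w, d'.target = d.source := by
  obtain ⟨l₁, l₂, rfl⟩ := List.append_of_mem hd
  obtain ⟨-, -, hc, hcl⟩ := hw
  rcases List.eq_nil_or_concat l₁ with rfl | ⟨l, a, rfl⟩
  · rcases List.eq_nil_or_concat l₂ with rfl | ⟨l, a, rfl⟩
    · exact ⟨d, by simp, by simpa using hcl⟩
    · refine ⟨a, by simp, ?_⟩
      simpa [List.getLast?_cons, List.getLast?_append] using hcl
  · refine ⟨a, by simp, ?_⟩
    rw [List.isChain_append] at hc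
    exact hc.2.2 a (by simp) d (by simp)

/-- A cycle that passes through an R-vertex has two edges there. -/
theorem IsCycle.exists_other_edge {w : List (DSRDart S R)} (hw : G.IsCycle w) {e : DSREdge S R}
    (he : e ∈ w.map DSRDart.edge) : ∃ e' ∈ w.map DSRDart.edge, e'.r = e.r ∧ e' ≠ e := by
  obtain ⟨d, hd, rfl⟩ := List.mem_map.1 he
  have hinj := List.inj_on_of_nodup_map hw.2.2
  obtain ⟨⟨s, r, σ⟩, f⟩ := d
  cases f with
  | true =>
    obtain ⟨⟨⟨s', r', σ'⟩, f'⟩, hd', h⟩ := hw.1.exists_source_eq_target hd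
    cases f' with
    | true => simp [DSRDart.source, DSRDart.target] at h
    | false =>
      refine ⟨_, List.mem_map_of_mem hd', by simpa [DSRDart.source, DSRDart.target] using h,
        fun he' => ?_⟩
      simpa using congrArg DSRDart.forward (hinj hd' hd he')
  | false =>
    obtain ⟨⟨⟨s', r', σ'⟩, f'⟩, hd', h⟩ := hw.1.exists_target_eq_source hd
    cases f' with
    | false => simp [DSRDart.source, DSRDart.target] at h
    | true =>
      refine ⟨_, List.mem_map_of_mem hd', by simpa [DSRDart.source, DSRDart.target] using h,
        fun he' => ?_⟩
      simpa using congrArg DSRDart.forward (hinj hd' hd he')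

/-- If all R-vertices have degree at most two, then the components of the intersection of two
cycles have an even number of edges. -/
theorem not_haveOddIntersection_of_degree_le_two
    (hdeg : ∀ e e' e'' : DSREdge S R, (G.sToR e ∨ G.rToS e) → (G.sToR e' ∨ G.rToS e') →
      (G.sToR e'' ∨ G.rToS e'') → e'.r = e.r → e''.r = e.r → e' ≠ e → e'' ≠ e → e' = e'')
    {w₁ w₂ : List (DSRDart S R)} (h₁ : G.IsCycle w₁) (h₂ : G.IsCycle w₂) :
    ¬ HaveOddIntersection w₁ w₂ := by
  classical
  rintro ⟨-, ⟨e, he⟩, hodd⟩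
  have harc : ∀ w, G.IsCycle w → ∀ f ∈ w.map DSRDart.edge, G.sToR f ∨ G.rToS f := by
    intro w hw f hf
    obtain ⟨d, hd, rfl⟩ := List.mem_map.1 hf
    have := hw.1.2.1 d hd
    unfold HasArc at this
    split_ifs at this
    · exact .inl this
    · exact .inr this
  have hother : ∀ f ∈ commonEdges w₁ w₂, ∃ f' ∈ commonEdges w₁ w₂, f'.r = f.r ∧ f' ≠ f := by
    rintro f ⟨hf1, hf2⟩
    obtain ⟨a, ha, har, haf⟩ := h₁.exists_other_edge hf1
    obtain ⟨b, hb, hbr, hbf⟩ := h₂.exists_other_edge hf2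
    obtain rfl := hdeg f a b (harc _ h₁ _ hf1) (harc _ h₁ _ ha) (harc _ h₂ _ hb) har hbr haf hbf
    exact ⟨a, ⟨ha, hb⟩, har, haf⟩
  set E := commonEdges w₁ w₂ with hE
  have hsub : edgeComponent E e ⊆ E := by
    intro f hf
    rcases Relation.ReflTransGen.cases_tail hf with rfl | ⟨g, -, hg⟩
    · exact he
    · exact hg.2.1
  have hfin : (edgeComponent E e).Finite :=
    (List.finite_toSet (w₁.map DSRDart.edge)).subset fun f hf => (hsub hf).1
  refine Nat.not_even_iff_odd.2 (hodd e he) ?_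
  -- Count the component by R-vertices: each fibre consists of exactly two edges.
  rw [Set.ncard_eq_toFinset_card _ hfin, Finset.card_eq_sum_card_image DSREdge.r]
  refine Finset.even_sum _ fun r hr => ?_
  obtain ⟨f, hf, rfl⟩ := Finset.mem_image.1 hr
  rw [Set.Finite.mem_toFinset] at hf
  obtain ⟨f', hf'E, hf'r, hf'⟩ := hother f (hsub hf)
  have hf'c : f' ∈ edgeComponent E e :=
    Relation.ReflTransGen.tail hf ⟨hsub hf, hf'E, .inr hf'r.symm⟩
  have : (hfin.toFinset.filter fun g => g.r = f.r) = {f, f'} := by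
    ext g
    simp only [Finset.mem_filter, Set.Finite.mem_toFinset, Finset.mem_insert,
      Finset.mem_singleton]
    constructor
    · rintro ⟨hg, hgr⟩
      by_cases hgf : g = f
      · exact .inl hgf
      · exact .inr (hdeg f g f' (harc _ h₁ _ (hsub hf).1) (harc _ h₁ _ (hsub hg).1)
          (harc _ h₁ _ hf'E.1) hgr hf'r hgf hf')
    · rintro (rfl | rfl)
      · exact ⟨hf, rfl⟩
      · exact ⟨hf'c, hf'r⟩
  rw [this, Finset.card_pair hf'.symm]
  exact even_two

end General

end DSRGraph

/-! ### Cycles of length 4 and 6 in `dsrGraph A B`. -/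

namespace DSRGraph

variable {S R : Type*} {A : Matrix S R ℝ} {B : Matrix R S ℝ}

/-- The edge that comes from `B r s`. -/
noncomputable def edgeOf (B : Matrix R S ℝ) (s : S) (r : R) : DSREdge S R :=
  ⟨s, r, SignType.sign (B r s)⟩

/-- The closed walk `i → k → j → l → i`. -/
noncomputable def walkFour (A : Matrix S R ℝ) (B : Matrix R S ℝ) (i : S) (k : R) (j : S) (l : R) :
    List (DSRDart S R) :=
  [⟨edgeOf B i k, true⟩, ⟨edgeOf A.transpose j k, false⟩,
    ⟨edgeOf B j l, true⟩, ⟨edgeOf A.transpose i l, false⟩]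

/-- The closed walk `i₁ → k₁ → i₂ → k₂ → i₃ → k₃ → i₁`. -/
noncomputable def walkSix (A : Matrix S R ℝ) (B : Matrix R S ℝ) (i₁ : S) (k₁ : R) (i₂ : S) (k₂ : R)
    (i₃ : S) (k₃ : R) : List (DSRDart S R) :=
  [⟨edgeOf B i₁ k₁, true⟩, ⟨edgeOf A.transpose i₂ k₁, false⟩,
    ⟨edgeOf B i₂ k₂, true⟩, ⟨edgeOf A.transpose i₃ k₂, false⟩,
    ⟨edgeOf B i₃ k₃, true⟩, ⟨edgeOf A.transpose i₁ k₃, false⟩]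

theorem hasArc_true_iff (e : DSREdge S R) :
    (dsrGraph A B).HasArc ⟨e, true⟩ ↔ B e.r e.s ≠ 0 ∧ e = edgeOf B e.s e.r := by
  obtain ⟨s, r, σ⟩ := e
  simp [HasArc, dsrGraph, edgeOf, eq_comm]

theorem hasArc_false_iff (e : DSREdge S R) :
    (dsrGraph A B).HasArc ⟨e, false⟩ ↔ A e.s e.r ≠ 0 ∧ e = edgeOf A.transpose e.s e.r := by
  obtain ⟨s, r, σ⟩ := e
  simp [HasArc, dsrGraph, edgeOf, eq_comm]

theorem label_edgeOf_transpose {s : S} {r : R} (h : A s r ≠ 0) :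
    (dsrGraph A B).label (edgeOf A.transpose s r) = ENNReal.ofReal |A s r| := by
  simp [dsrGraph, edgeOf, h]

theorem label_edgeOf (hAB : SignCompatible A B) {s : S} {r : R} (hB : B r s ≠ 0) :
    (dsrGraph A B).label (edgeOf B s r) = if A s r = 0 then ∞ else ENNReal.ofReal |A s r| := by
  by_cases h : A s r = 0
  · simp [dsrGraph, edgeOf, h]
  · simp [dsrGraph, edgeOf, h, hAB.sign_eq h hB]

theorem isCycle_walkFour {i j : S} {k l : R} (hij : i ≠ j) (hkl : k ≠ l) (h1 : B k i ≠ 0)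
    (h2 : A j k ≠ 0) (h3 : B l j ≠ 0) (h4 : A i l ≠ 0) :
    (dsrGraph A B).IsCycle (walkFour A B i k j l) := by
  simp [IsCycle, IsClosedWalk, walkFour, HasArc, dsrGraph, DSRDart.source, DSRDart.target, edgeOf,
    hij, hij.symm, hkl, h1, h2, h3, h4]

theorem isCycle_walkSix {i₁ i₂ i₃ : S} {k₁ k₂ k₃ : R} (h12 : i₁ ≠ i₂) (h13 : i₁ ≠ i₃)
    (h23 : i₂ ≠ i₃) (g12 : k₁ ≠ k₂) (g13 : k₁ ≠ k₃) (g23 : k₂ ≠ k₃)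
    (h1 : B k₁ i₁ ≠ 0) (h2 : A i₂ k₁ ≠ 0) (h3 : B k₂ i₂ ≠ 0) (h4 : A i₃ k₂ ≠ 0)
    (h5 : B k₃ i₃ ≠ 0) (h6 : A i₁ k₃ ≠ 0) :
    (dsrGraph A B).IsCycle (walkSix A B i₁ k₁ i₂ k₂ i₃ k₃) := by
  simp [IsCycle, IsClosedWalk, walkSix, HasArc, dsrGraph, DSRDart.source, DSRDart.target, edgeOf,
    h12, h12.symm, h13, h13.symm, h23, g12, g13, g23, h1, h2, h3, h4, h5, h6]

theorem parity_walkFour (i j : S) (k l : R) :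
    parity (walkFour A B i k j l) = SignType.sign (B k i * A j k * B l j * A i l) := by
  simp [parity, walkSign, walkFour, edgeOf, sign_mul, mul_assoc]

theorem parity_walkSix (i₁ i₂ i₃ : S) (k₁ k₂ k₃ : R) :
    parity (walkSix A B i₁ k₁ i₂ k₂ i₃ k₃) =
      - SignType.sign (B k₁ i₁ * A i₂ k₁ * (B k₂ i₂ * A i₃ k₂) * (B k₃ i₃ * A i₁ k₃)) := by
  have : (-1 : SignType) ^ 3 = -1 := by decide
  simp [parity, walkSign, walkSix, edgeOf, sign_mul, mul_assoc, this]

theorem isSCycle_four_iff {G : DSRGraph S R} {a b c d : DSRDart S R} :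
    G.IsSCycle [a, b, c, d] ↔ G.IsCycle [a, b, c, d] ∧ (∀ x ∈ [a, b, c, d], G.label x.edge ≠ ∞) ∧
      G.label a.edge * G.label c.edge = G.label b.edge * G.label d.edge := by
  have he : Finset.univ.filter (fun i : Fin 4 => Even i.val) = {0, 2} := by decide
  have ho : Finset.univ.filter (fun i : Fin 4 => Odd i.val) = {1, 3} := by decide
  unfold IsSCycle
  simp only [List.length_cons, List.length_nil, Nat.reduceAdd, he, ho]
  simp

theorem isSCycle_six_iff {G : DSRGraph S R} {a b c d e f : DSRDart S R} :
    G.IsSCycle [a, b, c, d, e, f] ↔ G.IsCycle [a, b, c, d, e, f] ∧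
      (∀ x ∈ [a, b, c, d, e, f], G.label x.edge ≠ ∞) ∧
      G.label a.edge * G.label c.edge * G.label e.edge =
        G.label b.edge * G.label d.edge * G.label f.edge := by
  have he : Finset.univ.filter (fun i : Fin 6 => Even i.val) = {0, 2, 4} := by decide
  have ho : Finset.univ.filter (fun i : Fin 6 => Odd i.val) = {1, 3, 5} := by decide
  unfold IsSCycle
  simp only [List.length_cons, List.length_nil, Nat.reduceAdd, he, ho]
  simp [mul_assoc]

theorem isSCycle_four_rotate {G : DSRGraph S R} {a b c d : DSRDart S R}
    (hw : G.IsCycle [a, b, c, d]) (h : G.IsSCycle [b, c, d, a]) : G.IsSCycle [a, b, c, d] := by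
  rw [isSCycle_four_iff] at h ⊢
  refine ⟨hw, fun x hx => h.2.1 x ?_, ?_⟩
  · simp at hx ⊢; tauto
  · rw [h.2.2, mul_comm]

theorem isSCycle_six_rotate {G : DSRGraph S R} {a b c d e f : DSRDart S R}
    (hw : G.IsCycle [a, b, c, d, e, f]) (h : G.IsSCycle [b, c, d, e, f, a]) :
    G.IsSCycle [a, b, c, d, e, f] := by
  rw [isSCycle_six_iff] at h ⊢
  refine ⟨hw, fun x hx => h.2.1 x ?_, ?_⟩
  · simp at hx ⊢; tauto
  · rw [h.2.2]; ring

theorem isECycle_rotate {G : DSRGraph S R} {a : DSRDart S R} {w : List (DSRDart S R)}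
    (h : G.IsECycle (a :: w)) : G.IsECycle (w ++ [a]) := by
  obtain ⟨⟨⟨-, harc, hc, hcl⟩, hs, he⟩, hp⟩ := h
  refine ⟨⟨⟨by simp, fun d hd => harc d ?_, ?_, ?_⟩, ?_, ?_⟩, ?_⟩
  · simpa [or_comm] using hd
  · rw [List.isChain_append]
    refine ⟨hc.tail, by simp, fun x hx y hy => ?_⟩
    obtain rfl : a = y := by simpa using hy
    cases w with
    | nil => simp at hx
    | cons b w =>
      rw [List.getLast?_cons_cons, hx] at hcl
      simpa using hcl
  · cases w with
    | nil => simpa using hcl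
    | cons b w =>
      rw [List.getLast?_append]
      simpa using (List.isChain_cons_cons.1 hc).1
  · exact (((List.perm_append_singleton a w).map _).nodup_iff).2 hs
  · exact (((List.perm_append_singleton a w).map _).nodup_iff).2 he
  · rw [← hp, parity, parity, walkSign, walkSign, ((List.perm_append_singleton a w).map _).prod_eq,
      (List.perm_append_singleton a w).length_eq]

/-- If a label is infinite, the left product of entries vanishes while the right one does not, so
the equation also encodes finiteness of the labels. -/
theorem isSCycle_walkFour_iff (hAB : SignCompatible A B) {i j : S} {k l : R}
    (hw : (dsrGraph A B).IsCycle (walkFour A B i k j l)) (h1 : B k i ≠ 0)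
    (h2 : A j k ≠ 0) (h3 : B l j ≠ 0) (h4 : A i l ≠ 0) :
    (dsrGraph A B).IsSCycle (walkFour A B i k j l) ↔ |A i k * A j l| = |A j k * A i l| := by
  rw [walkFour] at hw ⊢
  rw [isSCycle_four_iff]
  by_cases h5 : A i k = 0
  · simp [label_edgeOf hAB h1, h5, h2, h4]
  by_cases h6 : A j l = 0
  · simp [label_edgeOf hAB h3, h6, h2, h4]
  simp [hw, label_edgeOf hAB h1, label_edgeOf hAB h3, label_edgeOf_transpose h2,
    label_edgeOf_transpose h4, h5, h6, ← ENNReal.ofReal_mul, ENNReal.ofReal_eq_ofReal_iff, abs_mul,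
    mul_nonneg]

theorem isSCycle_walkSix_iff (hAB : SignCompatible A B) {i₁ i₂ i₃ : S} {k₁ k₂ k₃ : R}
    (hw : (dsrGraph A B).IsCycle (walkSix A B i₁ k₁ i₂ k₂ i₃ k₃))
    (h1 : B k₁ i₁ ≠ 0) (h2 : A i₂ k₁ ≠ 0) (h3 : B k₂ i₂ ≠ 0) (h4 : A i₃ k₂ ≠ 0)
    (h5 : B k₃ i₃ ≠ 0) (h6 : A i₁ k₃ ≠ 0) :
    (dsrGraph A B).IsSCycle (walkSix A B i₁ k₁ i₂ k₂ i₃ k₃) ↔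
      |A i₁ k₁ * A i₂ k₂ * A i₃ k₃| = |A i₂ k₁ * A i₃ k₂ * A i₁ k₃| := by
  rw [walkSix] at hw ⊢
  rw [isSCycle_six_iff]
  by_cases h7 : A i₁ k₁ = 0
  · simp [label_edgeOf hAB h1, h7, h2, h4, h6]
  by_cases h8 : A i₂ k₂ = 0
  · simp [label_edgeOf hAB h3, h8, h2, h4, h6]
  by_cases h9 : A i₃ k₃ = 0
  · simp [label_edgeOf hAB h5, h9, h2, h4, h6]
  simp [hw, label_edgeOf hAB h1, label_edgeOf hAB h3, label_edgeOf hAB h5,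
    label_edgeOf_transpose h2, label_edgeOf_transpose h4, label_edgeOf_transpose h6, h7, h8, h9,
    ← ENNReal.ofReal_mul, abs_mul, mul_nonneg]
  exact ENNReal.ofReal_eq_ofReal_iff (by positivity) (by positivity)

theorem target_eq_source_iff {e e' : DSREdge S R} {f f' : Bool} :
    (⟨e, f⟩ : DSRDart S R).target = (⟨e', f'⟩ : DSRDart S R).source ↔
      f' = !f ∧ bif f then e.r = e'.r else e.s = e'.s := by
  cases f <;> cases f' <;> simp [DSRDart.source, DSRDart.target]

/-- Bipartiteness excludes odd lengths, and length at least 8 would need four S-vertices. In length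
2 the two arcs would be antiparallel, hence of equal sign and one repeated edge. -/
theorem IsCycle.length_eq (hAB : SignCompatible A B) [Fintype S] (hS : Fintype.card S = 3)
    {w : List (DSRDart S R)} (hw : (dsrGraph A B).IsCycle w) : w.length = 4 ∨ w.length = 6 := by
  obtain ⟨⟨hne, harc, hc, hcl⟩, hs, he⟩ := hw
  have four : ∀ a b c d : S, ¬ [a, b, c, d].Nodup := fun a b c d h => by
    have := h.length_le_card
    simp [hS] at this
  rcases w with _ | ⟨⟨e0, f0⟩, w⟩
  · simp at hne
  rcases w with _ | ⟨⟨e1, f1⟩, w⟩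
  · simp [target_eq_source_iff] at hcl
  rcases w with _ | ⟨⟨e2, f2⟩, w⟩
  · simp [target_eq_source_iff] at hcl hc
    obtain ⟨rfl, hc⟩ := hc
    obtain ⟨s0, r0, σ0⟩ := e0
    obtain ⟨s1, r1, σ1⟩ := e1
    cases f0 <;> simp [HasArc, dsrGraph] at harc hc hcl he <;> subst hc <;> subst hcl
    · exact absurd (harc.1.2.symm.trans
        ((hAB.sign_eq harc.1.1 harc.2.1).trans harc.2.2)) (by simpa using he)
    · exact absurd (harc.2.2.symm.trans
        ((hAB.sign_eq harc.2.1 harc.1.1).trans harc.1.2)).symm (by simpa using he)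
  rcases w with _ | ⟨⟨e3, f3⟩, w⟩
  · simp [target_eq_source_iff] at hcl hc
    obtain ⟨⟨rfl, -⟩, rfl, -⟩ := hc
    simp at hcl
  rcases w with _ | ⟨⟨e4, f4⟩, w⟩
  · simp
  rcases w with _ | ⟨⟨e5, f5⟩, w⟩
  · simp [target_eq_source_iff] at hcl hc
    obtain ⟨⟨rfl, -⟩, ⟨rfl, -⟩, ⟨rfl, -⟩, rfl, -⟩ := hc
    simp at hcl
  rcases w with _ | ⟨⟨e6, f6⟩, w⟩
  · simp
  rcases w with _ | ⟨⟨e7, f7⟩, w⟩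
  · simp [target_eq_source_iff] at hcl hc
    obtain ⟨⟨rfl, -⟩, ⟨rfl, -⟩, ⟨rfl, -⟩, ⟨rfl, -⟩, ⟨rfl, -⟩, rfl, -⟩ := hc
    simp at hcl
  · exfalso
    simp only [List.isChain_cons_cons, target_eq_source_iff] at hc
    obtain ⟨⟨rfl, -⟩, ⟨rfl, -⟩, ⟨rfl, -⟩, ⟨rfl, -⟩, ⟨rfl, -⟩, ⟨rfl, -⟩, ⟨rfl, -⟩, -⟩ := hc
    cases f0 with
    | true =>
      apply four e0.s e2.s e4.s e6.s
      simp [DSRDart.source] at hs ⊢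
      tauto
    | false =>
      apply four e1.s e3.s e5.s e7.s
      simp [DSRDart.source] at hs ⊢
      tauto

theorem IsCycle.exists_eq_walkFour {a b c d : DSRDart S R}
    (hw : (dsrGraph A B).IsCycle [a, b, c, d]) (ha : a.forward = true) :
    ∃ i j k l, i ≠ j ∧ k ≠ l ∧ B k i ≠ 0 ∧ A j k ≠ 0 ∧ B l j ≠ 0 ∧ A i l ≠ 0 ∧
      [a, b, c, d] = walkFour A B i k j l := by
  obtain ⟨e0, f0⟩ := a
  obtain ⟨e1, f1⟩ := b
  obtain ⟨e2, f2⟩ := c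
  obtain ⟨e3, f3⟩ := d
  obtain rfl : f0 = true := ha
  obtain ⟨⟨-, harc, hc, hcl⟩, hs, -⟩ := hw
  simp [target_eq_source_iff] at hc hcl
  obtain ⟨⟨rfl, h1⟩, ⟨rfl, h2⟩, rfl, h3⟩ := hc
  simp at hcl h1 h2 h3
  simp [hasArc_true_iff, hasArc_false_iff] at harc
  obtain ⟨⟨z0, a0⟩, ⟨z1, a1⟩, ⟨z2, a2⟩, z3, a3⟩ := harc
  simp [DSRDart.source] at hs
  refine ⟨e0.s, e2.s, e1.r, e3.r, by tauto, by tauto, by rwa [← h1], by rwa [← h2],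
    by rwa [← h3], by rwa [← hcl], ?_⟩
  rw [h1] at a0
  rw [h2] at a1
  rw [h3] at a2
  rw [hcl] at a3
  simp only [walkFour, ← a0, ← a1, ← a2, ← a3, Bool.not_true, Bool.not_false]

theorem IsCycle.exists_eq_walkSix {a b c d e f : DSRDart S R}
    (hw : (dsrGraph A B).IsCycle [a, b, c, d, e, f]) (ha : a.forward = true) :
    ∃ i₁ i₂ i₃ k₁ k₂ k₃, i₁ ≠ i₂ ∧ i₁ ≠ i₃ ∧ i₂ ≠ i₃ ∧ B k₁ i₁ ≠ 0 ∧ A i₂ k₁ ≠ 0 ∧ B k₂ i₂ ≠ 0 ∧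
      A i₃ k₂ ≠ 0 ∧ B k₃ i₃ ≠ 0 ∧ A i₁ k₃ ≠ 0 ∧
      [a, b, c, d, e, f] = walkSix A B i₁ k₁ i₂ k₂ i₃ k₃ := by
  obtain ⟨e0, f0⟩ := a
  obtain ⟨e1, f1⟩ := b
  obtain ⟨e2, f2⟩ := c
  obtain ⟨e3, f3⟩ := d
  obtain ⟨e4, f4⟩ := e
  obtain ⟨e5, f5⟩ := f
  obtain rfl : f0 = true := ha
  obtain ⟨⟨-, harc, hc, hcl⟩, hs, -⟩ := hw
  simp [target_eq_source_iff] at hc hcl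
  obtain ⟨⟨rfl, h1⟩, ⟨rfl, h2⟩, ⟨rfl, h3⟩, ⟨rfl, h4⟩, rfl, h5⟩ := hc
  simp at hcl h1 h2 h3 h4 h5
  simp [hasArc_true_iff, hasArc_false_iff] at harc
  obtain ⟨⟨z0, a0⟩, ⟨z1, a1⟩, ⟨z2, a2⟩, ⟨z3, a3⟩, ⟨z4, a4⟩, z5, a5⟩ := harc
  simp [DSRDart.source] at hs
  refine ⟨e0.s, e2.s, e4.s, e1.r, e3.r, e5.r, by tauto, by tauto, by tauto, by rwa [← h1],
    by rwa [← h2], by rwa [← h3], by rwa [← h4], by rwa [← h5], by rwa [← hcl], ?_⟩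
  rw [h1] at a0
  rw [h2] at a1
  rw [h3] at a2
  rw [h4] at a3
  rw [h5] at a4
  rw [hcl] at a5
  simp only [walkSix, ← a0, ← a1, ← a2, ← a3, ← a4, ← a5, Bool.not_true, Bool.not_false]

end DSRGraph

open DSRGraph

/-! ### From cycle conditions to identities between entries, and back. -/

section FromGraph

variable {S R : Type*} {A : Matrix S R ℝ} {B : Matrix R S ℝ}

theorem posFourCycleMinorsVanish_of_isSCycle (hAB : SignCompatible A B)
    (h : ∀ w, (dsrGraph A B).IsECycle w → w.length = 4 → (dsrGraph A B).IsSCycle w) :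
    PosFourCycleMinorsVanish A B := by
  intro i j k l hp
  by_cases hij : i = j
  · rw [hij]
  by_cases hkl : k = l
  · rw [hkl, mul_comm]
  have hne := hp.ne'
  simp only [ne_eq, mul_eq_zero, not_or] at hne
  obtain ⟨⟨⟨h1, h2⟩, h3⟩, h4⟩ := hne
  have hw := isCycle_walkFour hij hkl h1 h2 h3 h4
  have hs := h _ ⟨hw, by rw [parity_walkFour, sign_pos hp]⟩ rfl
  rw [isSCycle_walkFour_iff hAB hw h1 h2 h3 h4] at hs
  have hne : |A i k * A j l| ≠ 0 := hs ▸ abs_ne_zero.2 (mul_ne_zero h2 h4)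
  simp only [ne_eq, abs_eq_zero, mul_eq_zero, not_or] at hne
  refine eq_of_abs_eq_of_mul_pos hs ?_
  -- Times the cycle product, this is the product of the two sides and a square, so the two sides
  -- have the same sign.
  have := mul_pos (hAB.entry_mul_pos hne.1 h1) (hAB.entry_mul_pos hne.2 h3)
  have hB : 0 < (B k i * B l j) ^ 2 := by positivity
  refine (mul_pos_iff_of_pos_right hB).1 ((mul_pos hp this).trans_eq (by ring))

/-- If two R-vertices coincide, the walk is not a cycle. Removing the positive factor `A s r * B r
s` at the repeated vertex then leaves a positive closed 4-walk, covered by `h4`. -/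
theorem posSixCyclesBalanced_of_isSCycle (hAB : SignCompatible A B)
    (h4 : PosFourCycleMinorsVanish A B)
    (h : ∀ w, (dsrGraph A B).IsOCycle w → w.length = 6 → (dsrGraph A B).IsSCycle w) :
    PosSixCyclesBalanced A B := by
  intro i₁ i₂ i₃ k₁ k₂ k₃ h12 h13 h23 hp
  have hne := hp.ne'
  simp only [ne_eq, mul_eq_zero, not_or] at hne
  obtain ⟨⟨⟨b1, a2⟩, b2, a3⟩, b3, a1⟩ := hne
  by_cases g12 : k₁ = k₂
  · subst g12
    have := h4 i₁ i₃ k₁ k₃ ((mul_pos_iff_of_pos_right (hAB.entry_mul_pos a2 b2)).1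
      (hp.trans_eq (by ring)))
    linear_combination A i₂ k₁ * this
  by_cases g23 : k₂ = k₃
  · subst g23
    have := h4 i₂ i₁ k₂ k₁ ((mul_pos_iff_of_pos_right (hAB.entry_mul_pos a3 b3)).1
      (hp.trans_eq (by ring)))
    linear_combination A i₃ k₂ * this
  by_cases g13 : k₁ = k₃
  · subst g13
    have := h4 i₃ i₂ k₁ k₂ ((mul_pos_iff_of_pos_right (hAB.entry_mul_pos a1 b1)).1
      (hp.trans_eq (by ring)))
    linear_combination A i₁ k₁ * this
  have hw := isCycle_walkSix h12 h13 h23 g12 g13 g23 b1 a2 b2 a3 b3 a1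
  have hs := h _ ⟨hw, by rw [parity_walkSix, sign_pos hp]⟩ rfl
  rw [isSCycle_walkSix_iff hAB hw b1 a2 b2 a3 b3 a1] at hs
  have hne : |A i₁ k₁ * A i₂ k₂ * A i₃ k₃| ≠ 0 :=
    hs ▸ abs_ne_zero.2 (mul_ne_zero (mul_ne_zero a2 a3) a1)
  simp only [ne_eq, abs_eq_zero, mul_eq_zero, not_or] at hne
  refine eq_of_abs_eq_of_mul_pos hs ?_
  have := mul_pos (mul_pos (hAB.entry_mul_pos hne.1.1 b1) (hAB.entry_mul_pos hne.1.2 b2))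
    (hAB.entry_mul_pos hne.2 b3)
  have hB : 0 < (B k₁ i₁ * B k₂ i₂ * B k₃ i₃) ^ 2 := by positivity
  refine (mul_pos_iff_of_pos_right hB).1 ((mul_pos hp this).trans_eq (by ring))

/-- With three S-vertices, all e-cycles are s-cycles as soon as the corresponding products of
entries of `A` agree. -/
theorem DSRGraph.isSCycle_of_isECycle [Fintype S] (hS : Fintype.card S = 3)
    (hAB : SignCompatible A B)
    (h4 : ∀ i j k l, i ≠ j → 0 < B k i * A j k * B l j * A i l →
      |A i k * A j l| = |A j k * A i l|)
    (h6 : ∀ i₁ i₂ i₃ k₁ k₂ k₃, i₁ ≠ i₂ → i₁ ≠ i₃ → i₂ ≠ i₃ →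
      B k₁ i₁ * A i₂ k₁ * (B k₂ i₂ * A i₃ k₂) * (B k₃ i₃ * A i₁ k₃) < 0 →
      |A i₁ k₁ * A i₂ k₂ * A i₃ k₃| = |A i₂ k₁ * A i₃ k₂ * A i₁ k₃|)
    {w : List (DSRDart S R)} (hw : (dsrGraph A B).IsECycle w) : (dsrGraph A B).IsSCycle w := by
  have four : ∀ a b c d : DSRDart S R, a.forward = true → (dsrGraph A B).IsECycle [a, b, c, d] →
      (dsrGraph A B).IsSCycle [a, b, c, d] := by
    rintro a b c d ha ⟨hc, hp⟩
    obtain ⟨i, j, k, l, hij, -, b1, a2, b2, a1, he⟩ := hc.exists_eq_walkFour ha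
    rw [he] at hc hp ⊢
    rw [isSCycle_walkFour_iff hAB hc b1 a2 b2 a1]
    rw [parity_walkFour, sign_eq_one_iff] at hp
    exact h4 i j k l hij hp
  have six : ∀ a b c d e f : DSRDart S R, a.forward = true →
      (dsrGraph A B).IsECycle [a, b, c, d, e, f] →
      (dsrGraph A B).IsSCycle [a, b, c, d, e, f] := by
    rintro a b c d e f ha ⟨hc, hp⟩
    obtain ⟨i₁, i₂, i₃, k₁, k₂, k₃, h12, h13, h23, b1, a2, b2, a3, b3, a1, he⟩ :=
      hc.exists_eq_walkSix ha
    rw [he] at hc hp ⊢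
    rw [isSCycle_walkSix_iff hAB hc b1 a2 b2 a3 b3 a1]
    rw [parity_walkSix, neg_eq_iff_eq_neg, sign_eq_neg_one_iff] at hp
    exact h6 i₁ i₂ i₃ k₁ k₂ k₃ h12 h13 h23 hp
  -- Arcs alternate in direction, so rotating by one makes a cycle start at an S-vertex.
  have alt : ∀ (a b : DSRDart S R) (l : List (DSRDart S R)),
      (dsrGraph A B).IsECycle (a :: b :: l) → a.forward ≠ true → b.forward = true := by
    rintro ⟨ea, fa⟩ ⟨eb, fb⟩ l h hf
    have := (target_eq_source_iff.1 (List.isChain_cons_cons.1 h.1.1.2.2.1).1).1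
    simp_all
  rcases hw.1.length_eq hAB hS with hl | hl
  · obtain ⟨a, b, c, d, rfl⟩ := List.length_eq_four.1 hl
    by_cases ha : a.forward = true
    · exact four a b c d ha hw
    · exact isSCycle_four_rotate hw.1 (four b c d a (alt a b _ hw ha) (isECycle_rotate hw))
  · obtain ⟨a, b, c, d, e, f, rfl⟩ : ∃ a b c d e f, w = [a, b, c, d, e, f] := by
      match w, hl with
      | [a, b, c, d, e, f], _ => exact ⟨a, b, c, d, e, f, rfl⟩
    by_cases ha : a.forward = true
    · exact six a b c d e f ha hw
    · exact isSCycle_six_rotate hw.1 (six b c d e f a (alt a b _ hw ha) (isECycle_rotate hw))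

end FromGraph

/-! ### The `DSR^{[2]}` graph for `n = 3` -/

section Two

variable {R : Type*} {A : Matrix (Fin 3) R ℝ} {B : Matrix R (Fin 3) ℝ}

theorem SignCompatible.upperL_lowerL {n : ℕ} {A : Matrix (Fin n) R ℝ} {B : Matrix R (Fin n) ℝ}
    (h : SignCompatible A B) : SignCompatible (upperL A) (lowerL B) := by
  intro p c
  unfold upperL lowerL
  split_ifs
  · exact h _ _
  · simpa [and_comm, or_comm] using h p.1.1 c.1
  · simp

/-- Both columns must carry the one index common to `p` and `q`. The signs in `upperL` and `lowerL`
then cancel, leaving a positive closed 4-walk for `A`, `B`. -/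
theorem upperL_four_cycle (h4 : PosFourCycleMinorsVanish A B) (p q : IdxPair 3) (c d : R × Fin 3)
    (hpq : p ≠ q) (hp : 0 < lowerL B c p * upperL A q c * lowerL B d q * upperL A p d) :
    |upperL A p c * upperL A q d| = |upperL A q c * upperL A p d| := by
  obtain ⟨k, i⟩ := c
  obtain ⟨l, j⟩ := d
  rcases p.three_cases with rfl | rfl | rfl <;> rcases q.three_cases with rfl | rfl | rfl <;>
    fin_cases i <;> fin_cases j <;> simp [upperL, lowerL] at hp hpq ⊢ <;>
    simpa only [abs_mul] using congrArg abs (h4 _ _ _ _ hp)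

/-- The three columns carry the three different indices, and exactly three of the six factors bring
a minus sign. A negative product thus becomes a positive one for `A`, `B`. -/
theorem upperL_six_cycle (h6 : PosSixCyclesBalanced A B) (p₁ p₂ p₃ : IdxPair 3) (c₁ c₂ c₃ : R × Fin 3)
    (h12 : p₁ ≠ p₂) (h13 : p₁ ≠ p₃) (h23 : p₂ ≠ p₃)
    (hp : lowerL B c₁ p₁ * upperL A p₂ c₁ * (lowerL B c₂ p₂ * upperL A p₃ c₂) *
      (lowerL B c₃ p₃ * upperL A p₁ c₃) < 0) :
    |upperL A p₁ c₁ * upperL A p₂ c₂ * upperL A p₃ c₃| =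
      |upperL A p₂ c₁ * upperL A p₃ c₂ * upperL A p₁ c₃| := by
  obtain ⟨k₁, l₁⟩ := c₁
  obtain ⟨k₂, l₂⟩ := c₂
  obtain ⟨k₃, l₃⟩ := c₃
  rcases p₁.three_cases with rfl | rfl | rfl <;> rcases p₂.three_cases with rfl | rfl | rfl <;>
    rcases p₃.three_cases with rfl | rfl | rfl <;> simp at h12 h13 h23 <;>
    fin_cases l₁ <;> simp [upperL, lowerL] at hp <;> fin_cases l₂ <;> simp at hp <;>
    fin_cases l₃ <;> simp at hp <;> simp [upperL] <;>
    -- Column `l` joins the pairs `{l, a}` and `{l, b}` through the entries with indices `a` and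
    -- `b`. The induced walk is `l₃ → k₁ → l₂ → k₃ → l₁ → k₂ → l₃`, whence the order `k₁ k₃ k₂`.
    simpa only [abs_mul, mul_right_comm] using congrArg abs (h6 _ _ _ k₁ k₃ k₂ (by decide)
      (by decide) (by decide) (hp.trans_eq (mul_right_comm _ _ _)))

/-- Only two of the three pairs contain a given index, and sign compatibility allows at most one
edge between two vertices. -/
theorem dsrGraphTwo_edge_eq (hAB : SignCompatible A B)
    (e e' e'' : DSREdge (IdxPair 3) (R × Fin 3))
    (he : (dsrGraphTwo A B).sToR e ∨ (dsrGraphTwo A B).rToS e)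
    (he' : (dsrGraphTwo A B).sToR e' ∨ (dsrGraphTwo A B).rToS e')
    (he'' : (dsrGraphTwo A B).sToR e'' ∨ (dsrGraphTwo A B).rToS e'')
    (hr' : e'.r = e.r) (hr'' : e''.r = e.r) (hne' : e' ≠ e) (hne'' : e'' ≠ e) : e' = e'' := by
  have mem : ∀ f, (dsrGraphTwo A B).sToR f ∨ (dsrGraphTwo A B).rToS f →
      f.r.2 = f.s.1.1 ∨ f.r.2 = f.s.1.2 := by
    rintro f (hf | hf)
    · by_contra! hn
      exact hf.1 (by simp [lowerL, hn])
    · by_contra! hn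
      exact hf.1 (by simp [upperL, hn])
  have ext : ∀ f g, (dsrGraphTwo A B).sToR f ∨ (dsrGraphTwo A B).rToS f →
      (dsrGraphTwo A B).sToR g ∨ (dsrGraphTwo A B).rToS g → f.s = g.s → f.r = g.r → f = g := by
    rintro ⟨s, r, σ⟩ ⟨s', r', τ⟩ hf hg rfl rfl
    simp only [DSREdge.mk.injEq, true_and]
    rcases hf with ⟨h1, h2⟩ | ⟨h1, h2⟩ <;> rcases hg with ⟨h3, h4⟩ | ⟨h3, h4⟩ 
    · exact h2.symm.trans h4
    · exact h2.symm.trans ((hAB.upperL_lowerL.sign_eq h3 h1).symm.trans h4)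
    · exact h2.symm.trans ((hAB.upperL_lowerL.sign_eq h1 h3).trans h4)
    · exact h2.symm.trans h4
  have comb : ∀ (l : Fin 3) (p q r : IdxPair 3), (l = p.1.1 ∨ l = p.1.2) →
      (l = q.1.1 ∨ l = q.1.2) → (l = r.1.1 ∨ l = r.1.2) → q ≠ p → r ≠ p → q = r := by
    decide
  have m := mem e he
  have m' := mem e' he'
  have m'' := mem e'' he''
  rw [hr'] at m'
  rw [hr''] at m''
  exact ext e' e'' he' he'' (comb _ _ _ _ m m' m'' (fun h => hne' (ext _ _ he' he h hr'))
    fun h => hne'' (ext _ _ he'' he h hr'')) (hr'.trans hr''.symm)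

theorem isOddStar_dsrGraphTwo (hAB : SignCompatible A B) (h4 : PosFourCycleMinorsVanish A B)
    (h6 : PosSixCyclesBalanced A B) : (dsrGraphTwo A B).IsOddStar :=
  ⟨fun _ hw => isSCycle_of_isECycle (by decide) hAB.upperL_lowerL
      (fun p q c d => upperL_four_cycle h4 p q c d) (upperL_six_cycle h6) hw,
    fun _ _ h₁ h₂ => not_haveOddIntersection_of_degree_le_two (dsrGraphTwo_edge_eq hAB) h₁.1 h₂.1⟩

end Two

theorem mainTheorem1 (m : ℕ) (C A : Matrix (Fin 3) (Fin m) ℝ) (B : Matrix (Fin m) (Fin 3) ℝ)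
    (hA : A ∈ qualClosure C) (hB : B.transpose ∈ qualClosure C)
    (h4 : ∀ w, (dsrGraph A B).IsECycle w → w.length = 4 → (dsrGraph A B).IsSCycle w)
    (h6 : ∀ w, (dsrGraph A B).IsOCycle w → w.length = 6 → (dsrGraph A B).IsSCycle w) :
    (dsrGraphTwo A B).IsOddStar ∧
      IsPZeroMatrix (additiveCompoundTwo (A * B)) ∧
      ∀ z ∈ spectrum ℂ ((A * B).map (algebraMap ℝ ℂ)), z.im ≠ 0 → ¬ z.re < 0 := by
  have hAB := signCompatible_of_mem_qualClosure hA hB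
  have hm := posFourCycleMinorsVanish_of_isSCycle hAB h4
  have hb := posSixCyclesBalanced_of_isSCycle hAB hm h6
  exact ⟨isOddStar_dsrGraphTwo hAB hm hb, isPZeroMatrix_additiveCompoundTwo hAB hm hb,
    fun _ hz him => re_nonneg_of_mem_spectrum (hAB.trace_mul_sub_det_nonneg hm hb) hz him⟩
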